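/- Consider $N$ transmitter–receiver pairs (users) sharing a Gaussian interference channel with unit-variance noise. The power gain $H_{ij}(k)$ (the squared magnitude of the channel coefficient) from transmitter $j$ to receiver $i$ in slot $k$ takes values in a finite set $\mathcal H_d\subset[0,\infty)$ with distribution $\pi_d$ if $i=j$, and in a finite set $\mathcal H_c\subset[0,\infty)$ with distribution $\pi_c$ if $i\ne j$; all gains are independent over slots $k$ and over links $(i,j)$. Let $\mathcal H$ be the finite set of channel states $h=(h_{ij})_{i,j}$, let $H(k)=(H_{ij}(k))_{i,j}$, and let $\overline P_i\ge 0$ be the average power budget of user $i$. A stationary policy of user $i$ is a function $P_i:\mathcal H\to[0,\infty)$, giving the transmit power in each state. For a profile $P=(P_1,\dots,P_N)$ put $$\Gamma_i(P(h))=\frac{h_{ii}P_i(h)}{1+\sum_{j\ne i}h_{ij}P_j(h)} .$$ The payoff of user $i$ is its long-term average rate $$r_i(P)=\limsup_{n\to\infty}\frac1n\sum_{k=1}^n\mathbb E\big[\log\big(1+\Gamma_i(P(H(k)))\big)\big],$$ and its strategy set $\mathcal A_i$ consists of the stationary policies allowed by its information that satisfy $$\limsup_{n\to\infty}\frac1n\sum_{k=1}^n\mathbb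 E[P_i(H(k))]\le\overline P_i .$$ Three games are considered, according to what user $i$ knows in each slot: - $\mathcal G_A$ (complete information): $P_i(h)$ may depend on all of $h$; - $\mathcal G_I$ (incident gains): $P_i(h)$ depends only on the gains $(h_{ij})_{j=1}^N$ into receiver $i$; the expected rate is computed as $\mathbb E_{H_i}\big[\mathbb E_{H_{-i}}[\,\cdot\,]\big]$, where $H_i=(H_{ij})_j$ and $H_{-i}$ denotes all other gains; - $\mathcal G_D$ (direct gain only): $P_i(h)$ depends only on $h_{ii}$; the expected rate is computed as $\mathbb E_{H_{ii}}\big[\mathbb E_{H_{-ii}}[\,\cdot\,]\big]$, where $H_{-ii}$ denotes all gains other than $H_{ii}$. A profile $P^*$ with $P_i^*\in\mathcal A_i$ for all $i$ is a (pure-strategy) Nash equilibrium if $r_i(P_i^*,P_{-i}^*)\ge r_i(P_i,P_{-i}^*)$ for every user $i$ and every $P_i\in\mathcal A_i$. Then each of the games $\mathcal G_A$, $\mathcal G_I$, $\mathcal G_D$ has at least one pure-strategy Nash equilibrium in stationary policies. Moreover, in each game there is a profile that is a Nash equilibrium both in the long-term formulation above and in the single-slot formulation, in which the long-term averages are replaced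 by the expectations $\mathbb E_H[\cdot]$ over one channel state $H$ (with the same nested expectations for $\mathcal G_I$ and $\mathcal G_D$). -/

import Mathlib

open MeasureTheory ProbabilityTheory Filter
open scoped NNReal

noncomputable section

/-- A strategic game: each player `i` has a set of admissible (pure) strategies and a real payoff
depending on the strategy profile. -/
structure StrategicGame (ι : Type*) (S : ι → Type*) where
  strategies : (i : ι) → Set (S i)
  payoff : ι → ((i : ι) → S i) → ℝ

/-- Pure-strategy Nash equilibrium: an admissible profile such that no player gains by a unilateral
deviation to another admissible strategy. -/
def StrategicGame.IsNashEquilibrium {ι : Type*} [DecidableEq ι] {S : ι → Type*}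
    (G : StrategicGame ι S) (s : (i : ι) → S i) : Prop :=
  (∀ i, s i ∈ G.strategies i) ∧
    ∀ i, ∀ t ∈ G.strategies i, G.payoff i (Function.update s i t) ≤ G.payoff i s

/-- What user `i` knows about the channel: all gains, the gains of all links into receiver `i`,
or the gain of its own direct link only. -/
inductive ChannelInformation
  | complete
  | incident
  | direct

/-- `info.Observes i a b`: user `i` knows the gain of the link from transmitter `b` to
receiver `a`. -/
def ChannelInformation.Observes {N : ℕ} (info : ChannelInformation) (i a b : Fin N) : Prop :=
  match info with
  | .complete => True
  | .incident => a = i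
  | .direct => a = i ∧ b = i

/-- Data of the Gaussian interference channel with `N` transmitter-receiver pairs: finite sets of
direct and cross channel power gains, probability distributions on them, and the average power
budgets of the users. All gains are power gains `|H_ij|^2`. -/
structure InterferenceChannel (N : ℕ) where
  directGains : Finset ℝ≥0
  crossGains : Finset ℝ≥0
  directLaw : PMF ℝ≥0
  crossLaw : PMF ℝ≥0
  directLaw_support : directLaw.support ⊆ (directGains : Set ℝ≥0)
  crossLaw_support : crossLaw.support ⊆ (crossGains : Set ℝ≥0)
  powerBudget : Fin N → ℝ≥0

namespace InterferenceChannel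

variable {N : ℕ} (C : InterferenceChannel N)

/-- Possible power gains from transmitter `j` to receiver `i`. -/
def gains (i j : Fin N) : Finset ℝ≥0 := if i = j then C.directGains else C.crossGains

/-- Distribution of the power gain from transmitter `j` to receiver `i`. -/
def linkLaw (i j : Fin N) : PMF ℝ≥0 := if i = j then C.directLaw else C.crossLaw

/-- A channel state: the entry `h i j` is the power gain from transmitter `j` to receiver `i`. -/
abbrev State : Type := (i j : Fin N) → C.gains i j

/-- A stationary power policy of one user: the transmit power in each channel state. -/
abbrev Policy : Type := C.State → ℝ

/-- A power profile: one stationary policy for each user. -/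
abbrev Profile : Type := Fin N → C.Policy

/-- The signal to interference plus noise ratio of user `i` in state `h`. -/
def sinr (P : C.Profile) (i : Fin N) (h : C.State) : ℝ :=
  ((h i i : ℝ≥0) : ℝ) * P i h /
    (1 + ∑ j ∈ Finset.univ.erase i, ((h i j : ℝ≥0) : ℝ) * P j h)

/-- The rate that user `i` gets in state `h`. -/
def instantRate (P : C.Profile) (i : Fin N) (h : C.State) : ℝ :=
  Real.log (1 + C.sinr P i h)

open Classical in
/-- The state whose links satisfying `own` are taken from `h` and the others from `h'`. -/
def splice (own : Fin N → Fin N → Prop) (h h' : C.State) : C.State :=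
  fun a b => if own a b then h a b else h' a b

/-- The expected rate of user `i`, where `E f` is the expectation of `f (H)` for the random channel
state `H`. With complete information it is the expectation over `H`. With partial information it is
the expectation over the gains known to user `i` of the expectation over all remaining gains; each
of the two is taken with respect to the distribution of the gains in question. -/
def expectedRate (E : (C.State → ℝ) → ℝ) (info : ChannelInformation)
    (i : Fin N) (P : C.Profile) : ℝ :=
  match info with
  | .complete => E fun h => C.instantRate P i h
  | info => E fun h => E fun h' => C.instantRate P i (C.splice (info.Observes i) h h')

/-- Admissible stationary policies of user `i`: nonnegative powers that depend only on the gains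
known to the user and whose average, computed by `avgPower`, is at most the power budget. -/
def admissible (info : ChannelInformation) (avgPower : C.Policy → ℝ) (i : Fin N) :
    Set C.Policy :=
  {p | (∀ h, 0 ≤ p h) ∧
    (∀ h h' : C.State, (∀ a b, info.Observes i a b → h a b = h' a b) → p h = p h') ∧
    avgPower p ≤ C.powerBudget i}

/-- `H k i j` is the gain from transmitter `j` to receiver `i` in slot `k`. The gains have the
prescribed distributions and are independent over slots and over links. -/
structure IsIIDFading {Ω : Type*} [MeasurableSpace Ω] (μ : Measure Ω)
    (H : ℕ → (i j : Fin N) → Ω → C.gains i j) : Prop where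
  measurable : ∀ k i j, Measurable (H k i j)
  law : ∀ k i j, μ.map (fun ω => (H k i j ω : ℝ≥0)) = (C.linkLaw i j).toMeasure
  indep : iIndepFun
    (fun (q : ℕ × Fin N × Fin N) ω => (H q.1 q.2.1 q.2.2 ω : ℝ≥0)) μ

/-- Expectation of a function of the channel state in slot `k`. -/
def slotExpectation {Ω : Type*} [MeasurableSpace Ω] (μ : Measure Ω)
    (H : ℕ → (i j : Fin N) → Ω → C.gains i j) (k : ℕ) (f : C.State → ℝ) : ℝ :=
  ∫ ω, f (fun i j => H k i j ω) ∂μ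

/-- The long-term average `limsup_n (1/n) ∑_{k=1}^n x k`. -/
def longTermAverage (x : ℕ → ℝ) : ℝ :=
  limsup (fun n : ℕ => (1 / (n : ℝ)) * ∑ k ∈ Finset.Icc 1 n, x k) atTop

/-- The power allocation game over stationary policies, with long-term average rates as payoffs
and long-term average power constraints. -/
def longTermGame {Ω : Type*} [MeasurableSpace Ω] (μ : Measure Ω)
    (H : ℕ → (i j : Fin N) → Ω → C.gains i j) (info : ChannelInformation) :
    StrategicGame (Fin N) (fun _ => C.Policy) where
  strategies := C.admissible info
    (fun p => longTermAverage fun k => C.slotExpectation μ H k p)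
  payoff := fun i P =>
    longTermAverage fun k => C.expectedRate (C.slotExpectation μ H k) info i P

/-- The probability of a channel state: the product of the probabilities of its gains. -/
def stateProb (h : C.State) : ℝ := ∏ i, ∏ j, (C.linkLaw i j (h i j)).toReal

/-- Expectation with respect to the distribution of the channel state. -/
def stateExpectation (f : C.State → ℝ) : ℝ := ∑ h, C.stateProb h * f h

/-- The power allocation game over stationary policies in single-slot form: the payoffs are
expected rates and the constraints bound the expected powers. -/
def stationaryGame (info : ChannelInformation) :
    StrategicGame (Fin N) (fun _ => C.Policy) where
  strategies := C.admissible info C.stateExpectation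
  payoff := C.expectedRate C.stateExpectation info

end InterferenceChannel

end

/-! For i.i.d. gains every slot expectation is the expectation under the product law of one state,
so each long-term average is the limsup of an eventually constant sequence. The long-term and
single-slot games are then equal (`longTermGame_eq_stationaryGame`), and one equilibrium serves
both.

The single-slot game falls under the Debreu–Glicksberg–Fan theorem
(`StrategicGame.exists_isNashEquilibrium`). Policies are vectors indexed by finitely many states,
the admissible sets are convex, and the own rate is the logarithm of an affine function of the own
power. Compactness can fail only through states of probability zero; truncation at `powerBound`
repairs this without affecting payoffs.

The existence theorem is Ky Fan's inequality applied to the total gain from unilateral deviations.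
Ky Fan's inequality reduces by compactness and Jensen to a KKM-type covering theorem on the simplex,
which is obtained as a limit of Scarf's combinatorial lemma, proved by a parity count. -/

noncomputable section

/-! ### Scarf's lemma by a door-in/door-out parity count -/

section Scarf

variable {X I : Type*} [DecidableEq X] [Fintype I] [DecidableEq I]

/-- In a set with as many elements as there are colors which does not show all colors, the number
of elements whose removal leaves all colors but `i₀` is even. -/
theorem even_card_filter_image_erase (c : X → I) (i₀ : I) (S : Finset X)
    (hS : S.card = Fintype.card I) (hc : S.image c ≠ Finset.univ) :
    Even (S.filter fun x => (S.erase x).image c = Finset.univ.erase i₀).card := by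
  -- After such a removal the number of elements equals the number of colors left, so no color
  -- repeats.
  have hinj : ∀ x ∈ S, (S.erase x).image c = Finset.univ.erase i₀ →
      Set.InjOn c (S.erase x : Finset X) := by
    intro x hx h
    rw [← Finset.card_image_iff, h, Finset.card_erase_of_mem (Finset.mem_univ _),
      Finset.card_erase_of_mem hx, hS, Finset.card_univ]
  rcases (S.filter fun x => (S.erase x).image c = Finset.univ.erase i₀).eq_empty_or_nonempty with
    h0 | ⟨x, hx⟩
  · simp [h0]
  obtain ⟨hxS, hx⟩ := Finset.mem_filter.1 hx
  have hS' : S.image c = insert (c x) (Finset.univ.erase i₀) := by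
    rw [← hx, ← Finset.image_insert, Finset.insert_erase hxS]
  have hcx : c x ≠ i₀ := by
    intro h
    rw [h, Finset.insert_erase (Finset.mem_univ _)] at hS'
    exact hc hS'
  obtain ⟨x', hx', hxx'⟩ : ∃ x' ∈ S.erase x, c x' = c x := by
    have : c x ∈ (S.erase x).image c := by rw [hx]; simp [hcx]
    simpa using this
  have hne := (Finset.mem_erase.1 hx').1
  have hx'S := (Finset.mem_erase.1 hx').2
  have hx'd : (S.erase x').image c = Finset.univ.erase i₀ := by
    rw [← hx]
    ext j
    simp only [Finset.mem_image, Finset.mem_erase]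
    constructor
    · rintro ⟨z, ⟨hz, hzS⟩, rfl⟩
      by_cases hzx : z = x
      · exact ⟨x', ⟨hne, hx'S⟩, by rw [hzx, hxx']⟩
      · exact ⟨z, ⟨hzx, hzS⟩, rfl⟩
    · rintro ⟨z, ⟨hz, hzS⟩, rfl⟩
      by_cases hzx : z = x'
      · exact ⟨x, ⟨hne.symm, hxS⟩, by rw [hzx, hxx']⟩
      · exact ⟨z, ⟨hzx, hzS⟩, rfl⟩
  -- A third removable element would leave both `x` and `x'`, which share a color, against `hinj`.
  have : (S.filter fun x => (S.erase x).image c = Finset.univ.erase i₀) = {x, x'} := by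
    ext z
    simp only [Finset.mem_filter, Finset.mem_insert, Finset.mem_singleton]
    constructor
    · rintro ⟨hzS, hz⟩
      by_contra! h
      exact hne (hinj z hzS hz (by simp [hx'S, Ne.symm h.2]) (by simp [hxS, Ne.symm h.1]) hxx')
    · rintro (rfl | rfl)
      exacts [⟨hxS, hx⟩, ⟨hx'S, hx'd⟩]
  rw [this, Finset.card_pair hne.symm]
  exact even_two

variable [Fintype X]

open Classical in
/-- Abstract door-in/door-out argument: if exactly one door with all colors but `i₀` belongs to an
odd number of rooms, then some room shows all colors. -/
theorem exists_image_eq_univ_of_odd (P : Finset X → Prop) (hP : ∀ s t, s ⊆ t → P t → P s)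
    (c : X → I) (i₀ : I) (d₀ : Finset X) (hd₀ : P d₀) (hd₀c : d₀.image c = Finset.univ.erase i₀)
    (hd₀n : d₀.card + 1 = Fintype.card I)
    (hodd : Odd (Finset.univ.filter fun y => y ∉ d₀ ∧ P (insert y d₀)).card)
    (heven : ∀ d, P d → d.image c = Finset.univ.erase i₀ → d.card + 1 = Fintype.card I → d ≠ d₀ →
      Even (Finset.univ.filter fun y => y ∉ d ∧ P (insert y d)).card) :
    ∃ S : Finset X, P S ∧ S.card = Fintype.card I ∧ S.image c = Finset.univ := by
  by_contra! hno
  set R : Finset (Finset X) := Finset.univ.filter fun S => P S ∧ S.card = Fintype.card I with hR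
  set D : Finset (Finset X) := Finset.univ.filter fun d =>
    P d ∧ d.image c = Finset.univ.erase i₀ ∧ d.card + 1 = Fintype.card I with hD
  -- Door–room incidences are counted both ways: without a fully colored room every room has evenly
  -- many doors, whereas `d₀` alone lies in an odd number of rooms.
  have hcount := Finset.sum_card_bipartiteAbove_eq_sum_card_bipartiteBelow
    (s := D) (t := R) (fun d S => d ⊆ S)
  have hroom : ∀ S ∈ R, Even (D.bipartiteBelow (fun d S => d ⊆ S) S).card := by
    intro S hS
    obtain ⟨hPS, hcard⟩ := (Finset.mem_filter.1 hS).2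
    have := even_card_filter_image_erase c i₀ S hcard (hno S hPS hcard)
    convert this using 1
    symm
    apply Finset.card_bij (fun x _ => S.erase x)
    · intro x hx
      obtain ⟨hxS, hx⟩ := Finset.mem_filter.1 hx
      simp only [Finset.bipartiteBelow, hD, Finset.mem_filter, Finset.mem_univ, true_and]
      refine ⟨⟨hP _ _ (Finset.erase_subset _ _) hPS, hx, ?_⟩, Finset.erase_subset _ _⟩
      rw [Finset.card_erase_add_one hxS, hcard]
    · intro x hx y hy h
      exact Finset.erase_injOn S (Finset.mem_filter.1 hx).1 (Finset.mem_filter.1 hy).1 h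
    · intro d hd
      simp only [Finset.bipartiteBelow, hD, Finset.mem_filter, Finset.mem_univ, true_and] at hd
      obtain ⟨⟨-, hdc, hdn⟩, hdS⟩ := hd
      obtain ⟨x, hx⟩ := Finset.card_eq_one.1
        (show (S \ d).card = 1 by rw [Finset.card_sdiff_of_subset hdS]; omega)
      have hxm : x ∈ S \ d := by simp [hx]
      have he : S.erase x = d := by
        rw [← Finset.sdiff_singleton_eq_erase, ← hx, Finset.sdiff_sdiff_eq_self hdS]
      exact ⟨x, Finset.mem_filter.2 ⟨(Finset.mem_sdiff.1 hxm).1, by rw [he, hdc]⟩, he⟩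
  have hdoor : ∀ d ∈ D, (R.bipartiteAbove (fun d S => d ⊆ S) d).card =
      (Finset.univ.filter fun y => y ∉ d ∧ P (insert y d)).card := by
    intro d hd
    obtain ⟨-, hdc, hdn⟩ := (Finset.mem_filter.1 hd).2
    symm
    apply Finset.card_bij (fun y _ => insert y d)
    · intro y hy
      obtain ⟨hyd, hy⟩ := (Finset.mem_filter.1 hy).2
      simp only [Finset.bipartiteAbove, hR, Finset.mem_filter, Finset.mem_univ, true_and]
      exact ⟨⟨hy, by rw [Finset.card_insert_of_notMem hyd, hdn]⟩, Finset.subset_insert _ _⟩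
    · intro y hy z hz h
      exact Finset.insert_inj (Finset.mem_filter.1 hy).2.1 |>.1 h
    · intro S hS
      simp only [Finset.bipartiteAbove, hR, Finset.mem_filter, Finset.mem_univ, true_and] at hS
      obtain ⟨⟨hPS, hSn⟩, hdS⟩ := hS
      obtain ⟨x, hx⟩ := Finset.card_eq_one.1
        (show (S \ d).card = 1 by rw [Finset.card_sdiff_of_subset hdS]; omega)
      have hxm : x ∈ S \ d := by simp [hx]
      have he : insert x d = S := by
        rw [Finset.insert_eq, ← hx, Finset.sdiff_union_of_subset hdS]
      exact ⟨x, Finset.mem_filter.2 ⟨Finset.mem_univ _, (Finset.mem_sdiff.1 hxm).2, by rwa [he]⟩,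
        he⟩
  have hd₀D : d₀ ∈ D := Finset.mem_filter.2 ⟨Finset.mem_univ _, hd₀, hd₀c, hd₀n⟩
  have h1 : Even (∑ S ∈ R, (D.bipartiteBelow (fun d S => d ⊆ S) S).card) :=
    Finset.even_sum _ hroom
  rw [← hcount, Finset.sum_congr rfl hdoor, ← Finset.add_sum_erase _ _ hd₀D] at h1
  have h2 : Even (∑ d ∈ D.erase d₀,
      (Finset.univ.filter fun y => y ∉ d ∧ P (insert y d)).card) := by
    refine Finset.even_sum _ fun d hd => ?_
    obtain ⟨hne, hd⟩ := Finset.mem_erase.1 hd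
    obtain ⟨a, b, e⟩ := (Finset.mem_filter.1 hd).2
    exact heven d a b e hne
  rw [Nat.even_add, iff_true_right h2] at h1
  exact Nat.not_even_iff_odd.2 hodd h1

variable {α : Type*} [LinearOrder α]

/-- A set is dominant for the family of orders given by `f` if no point lies strictly above the
minimum of the set in all of the orders. -/
def IsDominant {X I α : Type*} [LinearOrder α] (f : I → X → α) (S : Finset X) : Prop :=
  ∀ y, ∃ k, ∀ x ∈ S, f k y ≤ f k x

theorem IsDominant.mono {X I α : Type*} [LinearOrder α] {f : I → X → α} {s t : Finset X} (hst : s ⊆ t) (ht : IsDominant f t) :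
    IsDominant f s := fun y => (ht y).imp fun _ hk x hx => hk x (hst hx)

open Classical in
/-- A dominant set with one element less than there are orders extends in exactly two ways to a
larger dominant set, provided that no order is needed to bound the whole space. -/
theorem IsDominant.card_insert {f : I → X → α} (hf : ∀ k, Function.Injective (f k))
    {d : Finset X} (hd : IsDominant f d) (hdn : d.card + 1 = Fintype.card I) (hne : d.Nonempty)
    (hM : ∀ i, ∃ y, ∀ k, k ≠ i → ∃ x ∈ d, f k x < f k y) :
    (Finset.univ.filter fun y => y ∉ d ∧ IsDominant f (insert y d)).card = 2 := by
  choose m hmd hm using fun k => Finset.exists_min_image d (f k) hne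
  -- Testing dominance at `x` itself shows that each `x` in `d` is a minimum in some order. As `d`
  -- has one element less than there are orders, exactly one pair `a`, `b` of orders shares its
  -- minimum.
  have hsurj : ∀ x ∈ d, ∃ k, m k = x := by
    intro x hx
    obtain ⟨k, hk⟩ := hd x
    exact ⟨k, hf k (le_antisymm (hm k x hx) (hk _ (hmd k)))⟩
  obtain ⟨a, -, b, -, hab, hmab⟩ := Finset.exists_ne_map_eq_of_card_lt_of_maps_to
    (s := Finset.univ) (t := d) (f := m) (by rw [Finset.card_univ]; omega) (fun k _ => hmd k)
  have hinj : ∀ i j, i ≠ j → m i = m j → ∀ k l, k ≠ i → l ≠ i → m k = m l → k = l := by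
    intro i j hij hmij k l hk hl hkl
    have hs : Set.SurjOn m (Finset.univ.erase i : Finset I) d := by
      intro x hx
      obtain ⟨k, rfl⟩ := hsurj x hx
      by_cases hki : k = i
      · exact ⟨j, by simp [hij.symm], by rw [hki, hmij]⟩
      · exact ⟨k, by simp [hki], rfl⟩
    refine Finset.injOn_of_surjOn_of_card_le m (fun k _ => hmd k) hs ?_
      (by simp [hk]) (by simp [hl]) hkl
    rw [Finset.card_erase_of_mem (Finset.mem_univ _), Finset.card_univ]
    omega
  have hpair : ∀ k l, k ≠ l → m k = m l → (k = a ∧ l = b) ∨ (k = b ∧ l = a) := by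
    intro k l hkl h
    have h1 : k = a ∨ l = a := by
      by_contra! hc
      exact hkl (hinj a b hab hmab k l hc.1 hc.2 h)
    have h2 : k = b ∨ l = b := by
      by_contra! hc
      exact hkl (hinj b a hab.symm hmab.symm k l hc.1 hc.2 h)
    grind
  -- `M i` is the region above `d` in every order but `i`, and `w i` below is its top point in order
  -- `i`. The two extensions turn out to be `w a` and `w b`.
  let M : I → Finset X := fun i => Finset.univ.filter fun y => ∀ k, k ≠ i → f k (m k) < f k y
  have hMne : ∀ i, (M i).Nonempty := by
    intro i
    obtain ⟨y, hy⟩ := hM i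
    refine ⟨y, Finset.mem_filter.2 ⟨Finset.mem_univ _, fun k hk => ?_⟩⟩
    obtain ⟨x, hx, hxy⟩ := hy k hk
    exact (hm k x hx).trans_lt hxy
  choose w hwM hw using fun i => Finset.exists_max_image (M i) (f i) (hMne i)
  have hwM' : ∀ i k, k ≠ i → f k (m k) < f k (w i) := fun i => (Finset.mem_filter.1 (hwM i)).2
  have hforward : ∀ i j, i ≠ j → m i = m j →
      w i ∉ d ∧ IsDominant f (insert (w i) d) := by
    intro i j hij hmij
    constructor
    · intro hwd
      obtain ⟨k, hk⟩ := hsurj _ hwd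
      by_cases hki : k = i
      · have := hwM' i j hij.symm
        rw [← hmij, ← hki, hk, hki] at this
        exact lt_irrefl _ this
      · have := hwM' i k hki
        rw [hk] at this
        exact lt_irrefl _ this
    · intro z
      by_contra! hz
      have key : ∀ k, f k (m k) < f k z := by
        intro k
        obtain ⟨x, hx, hxz⟩ := hz k
        rcases Finset.mem_insert.1 hx with rfl | hx
        · by_cases hki : k = i
          · subst hki
            by_contra! hzk
            have hzM : z ∈ M k := by
              refine Finset.mem_filter.2 ⟨Finset.mem_univ _, fun l hl => ?_⟩
              obtain ⟨x', hx', hx'z⟩ := hz l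
              rcases Finset.mem_insert.1 hx' with rfl | hx'
              · exact (hwM' k l hl).trans hx'z
              · exact (hm l x' hx').trans_lt hx'z
            exact absurd (hw k z hzM) (not_le.2 hxz)
          · exact (hwM' i k hki).trans hxz
        · exact (hm k x hx).trans_lt hxz
      obtain ⟨k, hk⟩ := hd z
      exact absurd (hk _ (hmd k)) (not_le.2 (key k))
  have hback : ∀ y, y ∉ d → IsDominant f (insert y d) → y = w a ∨ y = w b := by
    intro y hyd hy
    have hne' : ∀ k, f k y ≠ f k (m k) := fun k h => hyd (hf k h ▸ hmd k)
    -- If `y` undercuts `d` in order `k`, the old minimum `m k` must remain minimal in some other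
    -- order, so `k` is `a` or `b`.
    have hbeat : ∀ k, f k y < f k (m k) → ∃ l, l ≠ k ∧ m k = m l ∧ f l (m l) < f l y := by
      intro k hk
      obtain ⟨l, hl⟩ := hy (m k)
      have hml : m k = m l := hf l (le_antisymm
        (hl _ (Finset.mem_insert_of_mem (hmd l))) (hm l _ (hmd k)))
      have h2 := hl y (Finset.mem_insert_self _ _)
      rw [hml] at h2
      refine ⟨l, ?_, hml, lt_of_le_of_ne h2 (hne' l).symm⟩
      rintro rfl
      exact absurd h2 (not_le.2 hk)
    have hfin : ∀ i, (∀ k, f k y < f k (m k) → k = i) → y = w i := by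
      intro i hk
      have hyM : y ∈ M i := Finset.mem_filter.2 ⟨Finset.mem_univ _, fun k hki =>
        lt_of_le_of_ne (not_lt.1 fun h => hki (hk k h)) (hne' k).symm⟩
      refine hf i (le_antisymm (hw i y hyM) ?_)
      obtain ⟨k, hk'⟩ := hy (w i)
      by_cases hki : k = i
      · subst hki
        exact hk' y (Finset.mem_insert_self _ _)
      · exact absurd (hk' _ (Finset.mem_insert_of_mem (hmd k))) (not_le.2 (hwM' i k hki))
    obtain ⟨k, hk⟩ := hy y
    have hk := lt_of_le_of_ne (hk _ (Finset.mem_insert_of_mem (hmd k))) (hne' k)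
    obtain ⟨l, hlk, hkl, hl⟩ := hbeat k hk
    have huniq : ∀ k', f k' y < f k' (m k') → k' = k := by
      intro k' hk'
      obtain ⟨l', hlk', hkl', hl'⟩ := hbeat k' hk'
      have h1 := hpair k l hlk.symm hkl
      have h2 := hpair k' l' hlk'.symm hkl'
      by_contra hne''
      have : k' = l := by grind
      subst this
      exact lt_asymm hk' hl
    rcases hpair k l hlk.symm hkl with ⟨rfl, -⟩ | ⟨rfl, -⟩
    · exact Or.inl (hfin k huniq)
    · exact Or.inr (hfin k huniq)
  -- A common point would lie above the minimum of `d` in all orders, against dominance of `d`.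
  have hwne : w a ≠ w b := by
    intro h
    obtain ⟨k, hk⟩ := hd (w a)
    have hk := hk _ (hmd k)
    by_cases hka : k = a
    · have := hwM' b k (hka ▸ hab)
      rw [← h] at this
      exact absurd hk (not_le.2 this)
    · exact absurd hk (not_le.2 (hwM' a k hka))
  rw [← Finset.card_pair hwne]
  congr 1
  ext y
  simp only [Finset.mem_filter, Finset.mem_univ, true_and, Finset.mem_insert,
    Finset.mem_singleton]
  constructor
  · rintro ⟨h1, h2⟩
    exact hback y h1 h2
  · rintro (rfl | rfl)
    exacts [hforward a b hab hmab, hforward b a hab.symm hmab.symm]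

/-- The orders of a finite set extended to slack points: the slack point of `k` is the least point
in the order `k`, and lies above all proper points in the other orders. -/
def slackOrder {T I : Type*} [DecidableEq I] (f : I → T → ℕ) (e : I → ℕ) (B : ℕ) (k : I) :
    T ⊕ I → ℕ
  | .inl t => f k t + 1
  | .inr j => if j = k then 0 else B + e j

open Classical in
/-- Scarf's lemma: if a finite set carries a family of linear orders and is colored by the indices
of the orders, there is a subset such that no point lies strictly above its minimum in each of the
orders whose color occurs in the subset. -/
theorem exists_dominant_image {T I : Type*} [Fintype T] [Nonempty T] [Fintype I]
    (f : I → T → ℕ) (hf : ∀ k, Function.Injective (f k)) (c : T → I) :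
    ∃ σ : Finset T, ∀ t, ∃ k ∈ σ.image c, ∀ x ∈ σ, f k t ≤ f k x := by
  obtain ⟨t₀⟩ := ‹Nonempty T›
  set i₀ := c t₀
  set e : I → ℕ := fun i => (Fintype.equivFin I i : ℕ)
  have he : Function.Injective e := fun i j h => (Fintype.equivFin I).injective (Fin.ext h)
  obtain ⟨B, hB⟩ : ∃ B, ∀ k t, f k t + 1 < B := by
    refine ⟨(∑ k, ∑ t, f k t) + 2, fun k t => ?_⟩
    have h1 : f k t ≤ ∑ t, f k t :=
      Finset.single_le_sum (f := f k) (fun _ _ => Nat.zero_le _) (Finset.mem_univ t)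
    have h2 : ∑ t, f k t ≤ ∑ k, ∑ t, f k t :=
      Finset.single_le_sum (f := fun k => ∑ t, f k t) (fun _ _ => Nat.zero_le _)
        (Finset.mem_univ k)
    omega
  set g := slackOrder f e B with hg
  have hgl : ∀ k t, g k (.inl t) = f k t + 1 := fun _ _ => rfl
  have hgs : ∀ k, g k (.inr k) = 0 := fun k => if_pos rfl
  have hgr : ∀ k j, j ≠ k → g k (.inr j) = B + e j := fun k j h => if_neg h
  have hginj : ∀ k, Function.Injective (g k) := by
    rintro k (t | j) (t' | j') h
    · rw [hgl, hgl] at h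
      rw [hf k (Nat.succ_injective h)]
    · by_cases hj : j' = k
      · subst hj; rw [hgl, hgs] at h; omega
      · rw [hgl, hgr _ _ hj] at h; have := hB k t; omega
    · by_cases hj : j = k
      · subst hj; rw [hgl, hgs] at h; omega
      · rw [hgl, hgr _ _ hj] at h; have := hB k t'; omega
    · by_cases hj : j = k <;> by_cases hj' : j' = k
      · rw [hj, hj']
      · subst hj; rw [hgs, hgr _ _ hj'] at h; have := hB j t₀; omega
      · subst hj'; rw [hgs, hgr _ _ hj] at h; have := hB j' t₀; omega
      · rw [hgr _ _ hj, hgr _ _ hj'] at h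
        rw [he (Nat.add_left_cancel h)]
  -- The exceptional door: all slack points but that of `i₀`. Its only room adds the proper point
  -- that is largest in order `i₀`.
  set d₀ : Finset (T ⊕ I) := (Finset.univ.erase i₀).image Sum.inr with hd₀
  have hd₀mem : ∀ j, Sum.inr j ∈ d₀ ↔ j ≠ i₀ := by simp [hd₀]
  have hd₀l : ∀ t, Sum.inl t ∉ d₀ := by simp [hd₀]
  have hslack : ∀ (S : Finset (T ⊕ I)) j, ∀ x ∈ S, g j (.inr j) ≤ g j x := by
    intro S j x _
    rw [hgs]
    exact Nat.zero_le _
  have hnot : ∀ S : Finset (T ⊕ I), (∀ j, Sum.inr j ∈ S) → ¬ IsDominant g S := by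
    intro S hS hdom
    obtain ⟨k, hk⟩ := hdom (.inl t₀)
    have := hk _ (hS k)
    rw [hgl, hgs] at this
    omega
  obtain ⟨tm, -, htm⟩ := Finset.exists_max_image Finset.univ (f i₀) ⟨t₀, Finset.mem_univ _⟩
  have hins : IsDominant g (insert (.inl tm) d₀) := by
    rintro (t | j)
    · refine ⟨i₀, fun x hx => ?_⟩
      rcases Finset.mem_insert.1 hx with rfl | hx
      · rw [hgl, hgl]
        exact Nat.succ_le_succ (htm t (Finset.mem_univ _))
      · rcases x with t' | j
        · exact absurd hx (hd₀l _)
        · rw [hgl, hgr _ _ ((hd₀mem j).1 hx)]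
          have := hB i₀ t
          omega
    · exact ⟨j, hslack _ j⟩
  have hd₀c : d₀.image (Sum.elim c id) = Finset.univ.erase i₀ := by
    rw [hd₀, Finset.image_image]
    simp
  obtain ⟨S, hS, hSn, hSc⟩ := exists_image_eq_univ_of_odd (IsDominant g)
    (fun s t => IsDominant.mono) (Sum.elim c id) i₀ d₀
    (hins.mono (Finset.subset_insert _ _)) hd₀c
    (by
      rw [hd₀, Finset.card_image_of_injective _ Sum.inr_injective,
        Finset.card_erase_add_one (Finset.mem_univ _), Finset.card_univ])
    (by
      have : (Finset.univ.filter fun y => y ∉ d₀ ∧ IsDominant g (insert y d₀)) = {.inl tm} := by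
        ext y
        simp only [Finset.mem_filter, Finset.mem_univ, true_and, Finset.mem_singleton]
        constructor
        · rintro ⟨hy, hdom⟩
          rcases y with t | j
          · obtain ⟨k, hk⟩ := hdom (.inl tm)
            have hk₀ : k = i₀ := by
              by_contra hne
              have := hk _ (Finset.mem_insert_of_mem ((hd₀mem k).2 hne))
              rw [hgl, hgs] at this
              omega
            subst hk₀
            have h1 := hk _ (Finset.mem_insert_self _ _)
            rw [hgl, hgl] at h1
            have h2 := htm t (Finset.mem_univ _)
            rw [hf i₀ (show f i₀ t = f i₀ tm by omega)]
          · refine absurd hdom (hnot _ fun l => ?_)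
            have hj : j = i₀ := by simpa [hd₀mem] using hy
            by_cases hl : l = i₀
            · rw [hl, hj]; exact Finset.mem_insert_self _ _
            · exact Finset.mem_insert_of_mem ((hd₀mem l).2 hl)
        · rintro rfl
          exact ⟨hd₀l _, hins⟩
      rw [this, Finset.card_singleton]
      exact odd_one)
    (by
      intro d hd hdc hdn hdd₀
      -- A door made of slack points only is determined by its colors, hence equals `d₀`.
      have hex : ∃ t, Sum.inl t ∈ d := by
        by_contra! hno
        refine hdd₀ (Finset.ext ?_)
        have hiff : ∀ j, Sum.inr j ∈ d ↔ j ∈ d.image (Sum.elim c id) := by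
          intro j
          simp [Finset.mem_image, hno]
        rintro (t | j)
        · simp [hno, hd₀l]
        · rw [hiff, hdc, hd₀mem]
          simp
      obtain ⟨t, ht⟩ := hex
      rw [hd.card_insert hginj hdn ⟨_, ht⟩ fun i => ⟨.inr i, fun k hk => ⟨.inl t, ht, ?_⟩⟩]
      · exact even_two
      · rw [hgl, hgr _ _ hk.symm]
        have := hB k t
        omega)
  refine ⟨Finset.univ.filter fun t => Sum.inl t ∈ S, fun t => ?_⟩
  obtain ⟨k, hk⟩ := hS (.inl t)
  -- The color `k` comes from a proper point: the slack point of `k` has value 0 in order `k`, below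
  -- `t`, so it cannot be in `S`.
  refine ⟨k, ?_, fun x hx => ?_⟩
  · have : k ∈ S.image (Sum.elim c id) := by rw [hSc]; exact Finset.mem_univ _
    obtain ⟨x | j, hx, hxk⟩ := Finset.mem_image.1 this
    · exact Finset.mem_image.2 ⟨x, by simpa using hx, hxk⟩
    · have hjk : j = k := hxk
      subst hjk
      have := hk _ hx
      rw [hgl, hgs] at this
      omega
  · have := hk _ (Finset.mem_filter.1 hx).2
    rw [hgl, hgl] at this
    omega

end Scarf

/-! ### A covering theorem for the simplex -/

section Covering

variable {I : Type*} [Fintype I]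

open Classical in
/-- In every coloring of the lattice points of a dilated simplex there is a point such that each
color either occurs nearby, or corresponds to a small coordinate of the point. -/
theorem exists_lattice_point_near_colors (m : ℕ) [Nonempty I] (c : (I → ℕ) → I) :
    ∃ x : I → ℕ, ∑ j, x j = m ∧ ∀ i, x i ≤ Fintype.card I ∨
      ∃ y : I → ℕ, ∑ j, y j = m ∧ c y = i ∧
        ∀ j, x j ≤ y j + Fintype.card I ∧ y j ≤ x j + Fintype.card I := by
  let T := (Finset.piAntidiag (Finset.univ : Finset I) m : Finset (I → ℕ))
  have hT : ∀ t : I → ℕ, t ∈ T ↔ ∑ j, t j = m := fun t => by simp [T, Finset.mem_piAntidiag]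
  have hTne : Nonempty T := by
    obtain ⟨i⟩ := ‹Nonempty I›
    exact ⟨⟨Pi.single i m, (hT _).2 (by simp)⟩⟩
  let e := Fintype.equivFin T
  -- Orders by the `k`-th coordinate, with ties broken by the enumeration `e`.
  let f : I → T → ℕ := fun k t => t.1 k * Fintype.card T + e t
  have hle : ∀ k t s, f k t ≤ f k s → t.1 k ≤ s.1 k := by
    intro k t s h
    by_contra! hlt
    have h1 : (s.1 k + 1) * Fintype.card T ≤ t.1 k * Fintype.card T :=
      Nat.mul_le_mul_right _ hlt
    have h2 := (e s).2
    simp only [f] at h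
    rw [add_mul, one_mul] at h1
    omega
  have hf : ∀ k, Function.Injective (f k) := by
    intro k t s h
    have h1 := le_antisymm (hle k t s h.le) (hle k s t h.ge)
    simp only [f, h1] at h
    exact e.injective (Fin.ext (by omega))
  obtain ⟨σ, hσ⟩ := exists_dominant_image f hf (fun t => c t.1)
  set C := σ.image fun t => c t.1 with hC
  obtain ⟨k₀, hk₀, -⟩ := hσ hTne.some
  obtain ⟨x₀, hx₀, -⟩ := Finset.mem_image.1 hk₀
  choose w hwσ hw using fun k => Finset.exists_min_image σ (fun x => x.1 k) ⟨x₀, hx₀⟩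
  -- Otherwise the point with coordinates one above the minima on `C`, the remaining mass being put
  -- on `k₀`, would beat `σ` in every order of `C`. So the minima on `C` nearly exhaust the total
  -- `m`, which bounds all other coordinates and all spreads.
  have hsum : m < ∑ k ∈ C, ((w k).1 k + 1) := by
    by_contra! hm
    let t : I → ℕ := fun k => (if k ∈ C then (w k).1 k + 1 else 0) +
      if k = k₀ then m - ∑ k ∈ C, ((w k).1 k + 1) else 0
    have ht : ∑ j, t j = m := by
      simp only [t, Finset.sum_add_distrib, Finset.sum_ite_mem, Finset.univ_inter,
        Finset.sum_ite_eq', Finset.mem_univ, if_true] at hm ⊢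
      omega
    obtain ⟨k, hk, hk'⟩ := hσ ⟨t, (hT t).2 ht⟩
    have := hle _ _ _ (hk' _ (hwσ k))
    simp only [t, if_pos hk] at this
    omega
  rw [Finset.sum_add_distrib, Finset.sum_const, smul_eq_mul, mul_one] at hsum
  have hCn : C.card ≤ Fintype.card I := Finset.card_le_univ C
  have hsmall : ∀ x ∈ σ, ∀ j, j ∉ C → x.1 j ≤ Fintype.card I := by
    intro x hx j hj
    have h1 : ∑ k ∈ insert j C, x.1 k ≤ ∑ k, x.1 k :=
      Finset.sum_le_sum_of_subset (Finset.subset_univ _)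
    rw [Finset.sum_insert hj, (hT _).1 x.2] at h1
    have h2 : ∑ k ∈ C, (w k).1 k ≤ ∑ k ∈ C, x.1 k := Finset.sum_le_sum fun k _ => hw k x hx
    omega
  have hclose : ∀ x ∈ σ, ∀ y ∈ σ, ∀ j, x.1 j ≤ y.1 j + Fintype.card I := by
    intro x hx y hy j
    by_cases hj : j ∈ C
    · have h1 : ∑ k ∈ C, x.1 k ≤ ∑ k, x.1 k :=
        Finset.sum_le_sum_of_subset (Finset.subset_univ _)
      rw [← Finset.add_sum_erase _ _ hj, (hT _).1 x.2] at h1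
      have h2 : ∑ k ∈ C.erase j, (w k).1 k ≤ ∑ k ∈ C.erase j, x.1 k :=
        Finset.sum_le_sum fun k _ => hw k x hx
      rw [← Finset.add_sum_erase _ _ hj] at hsum
      have := hw j y hy
      omega
    · exact (hsmall x hx j hj).trans (Nat.le_add_left _ _)
  refine ⟨x₀.1, (hT _).1 x₀.2, fun i => ?_⟩
  by_cases hi : i ∈ C
  · obtain ⟨y, hy, hyi⟩ := Finset.mem_image.1 hi
    exact Or.inr ⟨y.1, (hT _).1 y.2, hyi, fun j => ⟨hclose _ hx₀ _ hy j, hclose _ hy _ hx₀ j⟩⟩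
  · exact Or.inl (hsmall _ hx₀ i hi)

/-- If closed sets indexed by the vertices cover the standard simplex and each of them contains the
face opposite to its vertex, then they have a point in common. -/
theorem exists_mem_stdSimplex_forall_mem [Nonempty I] (F : I → Set (I → ℝ))
    (hF : ∀ i, IsClosed (F i)) (hcover : ∀ x ∈ stdSimplex ℝ I, ∃ i, x ∈ F i)
    (hface : ∀ x ∈ stdSimplex ℝ I, ∀ i, x i = 0 → x ∈ F i) :
    ∃ x ∈ stdSimplex ℝ I, ∀ i, x ∈ F i := by
  classical
  -- The dilation factor is `m + 1`, to avoid division by zero.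
  let pt : ℕ → (I → ℕ) → I → ℝ := fun m t i => (t i : ℝ) / (m + 1 : ℕ)
  have hpt : ∀ m t, ∑ j, t j = m + 1 → pt m t ∈ stdSimplex ℝ I := by
    intro m t ht
    refine ⟨fun i => by positivity, ?_⟩
    simp only [pt]
    rw [← Finset.sum_div, ← Nat.cast_sum, ht]
    exact div_self (by positivity)
  have hc : ∀ m, ∃ c : (I → ℕ) → I, ∀ t, ∑ j, t j = m + 1 → pt m t ∈ F (c t) := by
    intro m
    refine ⟨fun t => if h : ∑ j, t j = m + 1 then (hcover _ (hpt m t h)).choose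
      else Classical.arbitrary I, fun t ht => ?_⟩
    simp only [dif_pos ht]
    exact (hcover _ (hpt m t ht)).choose_spec
  choose c hc using hc
  choose x hx hxi using fun m => exists_lattice_point_near_colors (m + 1) (c m)
  obtain ⟨z, hz, φ, hφ, hlim⟩ := (isCompact_stdSimplex ℝ I).tendsto_subseq
    fun m => hpt m (x m) (hx m)
  refine ⟨z, hz, fun i => ?_⟩
  by_cases hzi : z i = 0
  · exact hface z hz i hzi
  have hpos : 0 < z i := lt_of_le_of_ne (hz.1 i) (Ne.symm hzi)
  have hsmall : Tendsto (fun m => (Fintype.card I : ℝ) / (φ m + 1 : ℕ)) atTop (nhds 0) :=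
    tendsto_const_nhds.div_atTop
      (tendsto_natCast_atTop_atTop.comp ((tendsto_add_atTop_nat 1).comp hφ.tendsto_atTop))
  have hev : ∀ᶠ m in atTop, (Fintype.card I : ℝ) / (φ m + 1 : ℕ) < pt (φ m) (x (φ m)) i :=
    hsmall.eventually_lt ((continuous_apply i).continuousAt.tendsto.comp hlim) hpos
  have hy : ∀ m, ∃ y : I → ℝ,
      (Fintype.card I : ℝ) / (φ m + 1 : ℕ) < pt (φ m) (x (φ m)) i →
      y ∈ F i ∧ ∀ j, |y j - pt (φ m) (x (φ m)) j| ≤ (Fintype.card I : ℝ) / (φ m + 1 : ℕ) := by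
    intro m
    have hm : (0 : ℝ) < (φ m + 1 : ℕ) := by positivity
    rcases hxi (φ m) i with h | ⟨y, hy, hyi, hxy⟩
    · refine ⟨z, fun hlt => absurd hlt (not_lt.2 ?_)⟩
      exact div_le_div_of_nonneg_right (by exact_mod_cast h) hm.le
    · refine ⟨pt (φ m) y, fun _ => ⟨hyi ▸ hc (φ m) y hy, fun j => ?_⟩⟩
      simp only [pt]
      rw [← sub_div, abs_div, abs_of_pos hm]
      refine div_le_div_of_nonneg_right ?_ hm.le
      have h1 : (x (φ m) j : ℝ) ≤ y j + Fintype.card I := by exact_mod_cast (hxy j).1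
      have h2 : (y j : ℝ) ≤ x (φ m) j + Fintype.card I := by exact_mod_cast (hxy j).2
      rw [abs_le]
      constructor <;> linarith
  choose y hy using hy
  have hylim : Tendsto y atTop (nhds z) := by
    rw [tendsto_pi_nhds]
    intro j
    have hxj : Tendsto (fun m => pt (φ m) (x (φ m)) j) atTop (nhds (z j)) :=
      (continuous_apply j).continuousAt.tendsto.comp hlim
    have : Tendsto (fun m => y m j - pt (φ m) (x (φ m)) j) atTop (nhds 0) :=
      squeeze_zero_norm' (hev.mono fun m hm => (hy m hm).2 j) hsmall
    simpa using this.add hxj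
  exact (hF i).mem_of_tendsto hylim (hev.mono fun m hm => (hy m hm).1)

end Covering

/-! ### Ky Fan's inequality -/

section KyFan

variable {V : Type*} [AddCommGroup V] [Module ℝ V] [TopologicalSpace V] [IsTopologicalAddGroup V]
  [ContinuousSMul ℝ V]

/-- Ky Fan's inequality for finitely many test points. -/
theorem exists_forall_le_zero_of_finite {I : Type*} [Fintype I] [Nonempty I] {K : Set V}
    (hconv : Convex ℝ K) (φ : V → V → ℝ) (hcont : ∀ y ∈ K, ContinuousOn (fun x => φ x y) K)
    (hconc : ∀ x ∈ K, ConcaveOn ℝ K (φ x)) (hdiag : ∀ x ∈ K, φ x x ≤ 0)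
    (y : I → V) (hy : ∀ i, y i ∈ K) : ∃ x ∈ K, ∀ i, φ x (y i) ≤ 0 := by
  let p : (I → ℝ) → V := fun l => ∑ i, l i • y i
  have hp : ∀ l ∈ stdSimplex ℝ I, p l ∈ K := fun l hl =>
    hconv.sum_mem (fun i _ => hl.1 i) hl.2 fun i _ => hy i
  have hpc : Continuous p := by fun_prop
  let ψ : I → (I → ℝ) → ℝ := fun i l => max (φ (p l) (y i)) 0
  have hψ : ∀ i, ContinuousOn (ψ i) (stdSimplex ℝ I) := fun i =>
    ((hcont _ (hy i)).comp hpc.continuousOn hp).sup continuousOn_const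
  -- At a common point both sides have the same sum over `i`, so the weights are proportional to the
  -- positive parts `ψ i`. If some `ψ i` were positive, only points with positive `φ` would carry
  -- weight, and Jensen would make the diagonal value positive.
  let F : I → Set (I → ℝ) := fun i => {l | l ∈ stdSimplex ℝ I ∧ l i * ∑ j, ψ j l ≤ ψ i l}
  have hF : ∀ i, IsClosed (F i) := fun i =>
    (isClosed_stdSimplex ℝ I).isClosed_le
      ((continuous_apply i).continuousOn.mul (continuousOn_finsetSum _ fun j _ => hψ j)) (hψ i)
  have hsum : ∀ l ∈ stdSimplex ℝ I, ∑ i, l i * ∑ j, ψ j l = ∑ i, ψ i l := fun l hl => by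
    rw [← Finset.sum_mul, hl.2, one_mul]
  obtain ⟨l, hl, hlF⟩ := exists_mem_stdSimplex_forall_mem F hF
    (fun l hl => by
      by_contra! h
      have : ∑ i, ψ i l < ∑ i, l i * ∑ j, ψ j l :=
        Finset.sum_lt_sum_of_nonempty Finset.univ_nonempty fun i _ =>
          not_le.1 fun hi => h i ⟨hl, hi⟩
      exact absurd (hsum l hl) this.ne')
    (fun l hl i hi => ⟨hl, by rw [hi, zero_mul]; exact le_max_right _ _⟩)
  have heq : ∀ i, l i * ∑ j, ψ j l = ψ i l := fun i =>
    (Finset.sum_eq_sum_iff_of_le fun i _ => (hlF i).2).1 (hsum l hl) i (Finset.mem_univ i)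
  refine ⟨p l, hp l hl, fun i => ?_⟩
  by_contra! hi
  have hS : 0 < ∑ j, ψ j l := Finset.sum_pos' (fun j _ => le_max_right _ _)
    ⟨i, Finset.mem_univ i, lt_max_of_lt_left hi⟩
  have hpos : ∀ j, 0 < l j → 0 < φ (p l) (y j) := by
    intro j hj
    have := heq j ▸ mul_pos hj hS
    exact (lt_max_iff.1 this).resolve_right (lt_irrefl _)
  have hli : 0 < l i := by
    have h1 : 0 < l i * ∑ j, ψ j l := by rw [heq i]; exact lt_max_of_lt_left hi
    exact pos_of_mul_pos_left h1 hS.le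
  have hJ : ∑ j, l j • φ (p l) (y j) ≤ φ (p l) (p l) :=
    (hconc _ (hp l hl)).le_map_sum (fun j _ => hl.1 j) hl.2 fun j _ => hy j
  have : 0 < ∑ j, l j • φ (p l) (y j) := by
    refine Finset.sum_pos' (fun j _ => ?_) ⟨i, Finset.mem_univ i, mul_pos hli hi⟩
    rcases (hl.1 j).eq_or_lt with h | h
    · rw [← h, zero_smul]
    · exact (mul_pos h (hpos j h)).le
  exact absurd (hdiag _ (hp l hl)) (not_le.2 (this.trans_le hJ))

/-- Ky Fan's inequality for functions that are concave in the second variable. -/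
theorem exists_forall_le_zero_of_concaveOn [T2Space V] {K : Set V} (hK : IsCompact K)
    (hconv : Convex ℝ K) (hne : K.Nonempty) (φ : V → V → ℝ)
    (hcont : ∀ y ∈ K, ContinuousOn (fun x => φ x y) K)
    (hconc : ∀ x ∈ K, ConcaveOn ℝ K (φ x)) (hdiag : ∀ x ∈ K, φ x x ≤ 0) :
    ∃ x ∈ K, ∀ y ∈ K, φ x y ≤ 0 := by
  obtain ⟨x, hx, hxy⟩ := hK.inter_iInter_nonempty (fun y : K => {x | x ∈ K ∧ φ x y ≤ 0})
    (fun y => hK.isClosed.isClosed_le (hcont y y.2) continuousOn_const)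
    (fun u => by
      rcases u.eq_empty_or_nonempty with rfl | hu
      · simpa using hne
      have : Nonempty u := hu.to_subtype
      obtain ⟨x, hx, h⟩ := exists_forall_le_zero_of_finite hconv φ hcont hconc hdiag
        (fun i : u => (i : K).1) (fun i => i.1.2)
      exact ⟨x, hx, Set.mem_iInter₂.2 fun y hy => ⟨hx, h ⟨y, hy⟩⟩⟩)
  exact ⟨x, hx, fun y hy => (Set.mem_iInter.1 hxy ⟨y, hy⟩).2⟩

end KyFan

/-! ### Equilibria of concave games -/

/-- A game with finitely many players, compact convex nonempty strategy sets and continuous payoffs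
that are concave in the own strategy has a pure-strategy Nash equilibrium. -/
theorem StrategicGame.exists_isNashEquilibrium {ι : Type*} [Fintype ι] [DecidableEq ι]
    {S : ι → Type*} [∀ i, AddCommGroup (S i)] [∀ i, Module ℝ (S i)] [∀ i, TopologicalSpace (S i)]
    [∀ i, IsTopologicalAddGroup (S i)] [∀ i, ContinuousSMul ℝ (S i)] [∀ i, T2Space (S i)]
    (G : StrategicGame ι S) (hcomp : ∀ i, IsCompact (G.strategies i))
    (hconv : ∀ i, Convex ℝ (G.strategies i)) (hne : ∀ i, (G.strategies i).Nonempty)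
    (hcont : ∀ i, ContinuousOn (G.payoff i) (Set.univ.pi G.strategies))
    (hconc : ∀ i, ∀ s ∈ Set.univ.pi G.strategies,
      ConcaveOn ℝ (G.strategies i) fun t => G.payoff i (Function.update s i t)) :
    ∃ s, G.IsNashEquilibrium s := by
  have hupd : ∀ s ∈ Set.univ.pi G.strategies, ∀ i, ∀ t ∈ G.strategies i,
      Function.update s i t ∈ Set.univ.pi G.strategies := by
    intro s hs i t ht j _
    by_cases hj : j = i
    · subst hj
      simpa using ht
    · simpa [Function.update_of_ne hj] using hs j (Set.mem_univ j)
  have hconvP : Convex ℝ (Set.univ.pi G.strategies) := convex_pi fun i _ => hconv i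
  obtain ⟨s, hs, h⟩ := exists_forall_le_zero_of_concaveOn
    (isCompact_univ_pi hcomp) hconvP (Set.univ_pi_nonempty_iff.2 hne)
    -- The Nikaido–Isoda function: the sum of the gains when each player alone switches from `s` to
    -- `t`.
    (fun s t => ∑ i, (G.payoff i (Function.update s i (t i)) - G.payoff i s))
    (fun t ht => continuousOn_finsetSum _ fun i _ =>
      ((hcont i).comp (continuous_id.update i continuous_const).continuousOn
        fun s hs => hupd s hs i _ (ht i (Set.mem_univ i))).sub (hcont i))
    (fun s hs => by
      refine ⟨hconvP, fun t ht t' ht' a b ha hb hab => ?_⟩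
      rw [smul_eq_mul, smul_eq_mul, Finset.mul_sum, Finset.mul_sum, ← Finset.sum_add_distrib]
      refine Finset.sum_le_sum fun i _ => ?_
      have := (hconc i s hs).2 (ht i (Set.mem_univ i)) (ht' i (Set.mem_univ i)) ha hb hab
      simp only [smul_eq_mul, Pi.add_apply, Pi.smul_apply] at this ⊢
      have h1 : G.payoff i s = a * G.payoff i s + b * G.payoff i s := by
        rw [← add_mul, hab, one_mul]
      linarith)
    (fun s _ => by simp)
  refine ⟨s, fun i => hs i (Set.mem_univ i), fun i t ht => ?_⟩
  -- A test profile differing from `s` only at `i` leaves just the gain of player `i` in the sum.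
  have := h _ (hupd s hs i t ht)
  rw [Finset.sum_eq_single i (fun j _ hj => by simp [Function.update_of_ne hj]) (by simp)] at this
  simpa using this

/-! ### From long-term averages to a single slot -/

namespace InterferenceChannel

variable {N : ℕ} (C : InterferenceChannel N)

theorem longTermAverage_const (x : ℝ) : longTermAverage (fun _ => x) = x := by
  -- The average over zero slots is 0 by convention, so equality is claimed only eventually.
  have : (fun n : ℕ => (1 / (n : ℝ)) * ∑ _k ∈ Finset.Icc 1 n, x) =ᶠ[atTop] fun _ => x := by
    filter_upwards [eventually_gt_atTop 0] with n hn
    have : (n : ℝ) ≠ 0 := by positivity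
    simp only [Finset.sum_const, Nat.card_Icc, nsmul_eq_mul, Nat.add_sub_cancel]
    field_simp
  rw [longTermAverage, limsup_congr this, limsup_const]

/-- Independence over links gives each state its product probability. The equality is between
functionals, so it also rewrites nested expectations. -/
theorem slotExpectation_eq_stateExpectation {Ω : Type*} [MeasurableSpace Ω] (μ : Measure Ω)
    [IsProbabilityMeasure μ] (H : ℕ → (i j : Fin N) → Ω → C.gains i j) (hH : C.IsIIDFading μ H)
    (k : ℕ) : C.slotExpectation μ H k = C.stateExpectation := by
  funext f
  let X : Ω → C.State := fun ω i j => H k i j ω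
  have hX : Measurable X := measurable_pi_lambda _ fun i => measurable_pi_lambda _ fun j =>
    hH.measurable k i j
  have hprob : IsProbabilityMeasure (μ.map X) := Measure.isProbabilityMeasure_map hX.aemeasurable
  have hmass : ∀ h : C.State, (μ.map X).real {h} = C.stateProb h := by
    intro h
    have hset : X ⁻¹' {h} = ⋂ q ∈ (Finset.univ : Finset (Fin N × Fin N)),
        (fun ω => (H k q.1 q.2 ω : ℝ≥0)) ⁻¹' {(h q.1 q.2 : ℝ≥0)} := by
      ext ω
      simp only [Set.mem_preimage, Set.mem_singleton_iff, Finset.mem_univ, Set.iInter_true,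
        Set.mem_iInter, Prod.forall, funext_iff, X, Subtype.ext_iff]
    have hind : iIndepFun (fun (q : Fin N × Fin N) ω => (H k q.1 q.2 ω : ℝ≥0)) μ :=
      hH.indep.precomp (g := fun q : Fin N × Fin N => (k, q)) fun _ _ h => (Prod.ext_iff.1 h).2
    rw [Measure.real, Measure.map_apply hX (MeasurableSet.singleton h), hset,
      hind.measure_inter_preimage_eq_mul _ fun q _ => MeasurableSet.singleton _,
      ENNReal.toReal_prod, Fintype.prod_prod_type, stateProb]
    refine Finset.prod_congr rfl fun i _ => Finset.prod_congr rfl fun j _ => ?_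
    have hm : Measurable fun ω => (H k i j ω : ℝ≥0) := (hH.measurable k i j).subtype_val
    rw [← Measure.map_apply hm (MeasurableSet.singleton _), hH.law,
      PMF.toMeasure_apply_singleton _ _ (MeasurableSet.singleton _)]
  have hf : Measurable f := measurable_of_finite f
  calc C.slotExpectation μ H k f = ∫ ω, f (X ω) ∂μ := rfl
    _ = ∫ h, f h ∂(μ.map X) := (integral_map hX.aemeasurable hf.aestronglyMeasurable).symm
    _ = ∑ h, (μ.map X).real {h} • f h := integral_fintype (Integrable.of_finite)
    _ = C.stateExpectation f := by simp only [hmass, smul_eq_mul, stateExpectation]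

/-- For independent and identically distributed gains the long-term and the single-slot power
allocation games coincide. -/
theorem longTermGame_eq_stationaryGame {Ω : Type*} [MeasurableSpace Ω] (μ : Measure Ω)
    [IsProbabilityMeasure μ] (H : ℕ → (i j : Fin N) → Ω → C.gains i j) (hH : C.IsIIDFading μ H)
    (info : ChannelInformation) : C.longTermGame μ H info = C.stationaryGame info := by
  simp only [longTermGame, stationaryGame, C.slotExpectation_eq_stateExpectation μ H hH,
    longTermAverage_const]

/-! ### Expected rates: null states, continuity, concavity -/

theorem stateProb_nonneg (h : C.State) : 0 ≤ C.stateProb h :=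
  Finset.prod_nonneg fun _ _ => Finset.prod_nonneg fun _ _ => ENNReal.toReal_nonneg

/-- The product form of the law makes any mixture of two possible states possible; hence null states
can be ignored in nested expectations too. -/
theorem stateProb_splice_ne_zero (own : Fin N → Fin N → Prop) {h h' : C.State}
    (hh : C.stateProb h ≠ 0) (hh' : C.stateProb h' ≠ 0) :
    C.stateProb (C.splice own h h') ≠ 0 := by
  simp only [stateProb, Finset.prod_ne_zero_iff, Finset.mem_univ, true_imp_iff] at hh hh' ⊢
  intro i j
  unfold splice
  split_ifs
  exacts [hh i j, hh' i j]

theorem stateExpectation_mono {f g : C.State → ℝ} (hfg : ∀ h, f h ≤ g h) :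
    C.stateExpectation f ≤ C.stateExpectation g :=
  Finset.sum_le_sum fun h _ => mul_le_mul_of_nonneg_left (hfg h) (C.stateProb_nonneg h)

theorem stateExpectation_congr {f g : C.State → ℝ} (hfg : ∀ h, C.stateProb h ≠ 0 → f h = g h) :
    C.stateExpectation f = C.stateExpectation g := by
  refine Finset.sum_congr rfl fun h _ => ?_
  by_cases hh : C.stateProb h = 0
  · rw [hh, zero_mul, zero_mul]
  · rw [hfg h hh]

theorem stateExpectation_add_smul (a b : ℝ) (f g : C.State → ℝ) :
    C.stateExpectation (fun h => a * f h + b * g h) =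
      a * C.stateExpectation f + b * C.stateExpectation g := by
  simp only [stateExpectation, Finset.mul_sum, ← Finset.sum_add_distrib]
  exact Finset.sum_congr rfl fun h _ => by ring

theorem continuous_stateExpectation : Continuous C.stateExpectation := by
  unfold stateExpectation
  fun_prop

theorem continuousOn_stateExpectation {V : Type*} [TopologicalSpace V] {K : Set V}
    {g : V → C.State → ℝ} (hg : ∀ h, ContinuousOn (fun v => g v h) K) :
    ContinuousOn (fun v => C.stateExpectation (g v)) K :=
  C.continuous_stateExpectation.comp_continuousOn (continuousOn_pi.2 hg)

theorem concaveOn_stateExpectation {V : Type*} [AddCommGroup V] [Module ℝ V] {K : Set V}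
    (hK : Convex ℝ K) {g : V → C.State → ℝ} (hg : ∀ h, ConcaveOn ℝ K fun v => g v h) :
    ConcaveOn ℝ K fun v => C.stateExpectation (g v) := by
  refine ⟨hK, fun v hv w hw a b ha hb hab => ?_⟩
  rw [smul_eq_mul, smul_eq_mul, ← stateExpectation_add_smul]
  exact C.stateExpectation_mono fun h => (hg h).2 hv hw ha hb hab

variable (info : ChannelInformation) (i : Fin N)

theorem expectedRate_congr {P Q : C.Profile}
    (hPQ : ∀ h, C.stateProb h ≠ 0 → C.instantRate P i h = C.instantRate Q i h) :
    C.expectedRate C.stateExpectation info i P = C.expectedRate C.stateExpectation info i Q := by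
  have hnested : ∀ own : Fin N → Fin N → Prop,
      (C.stateExpectation fun h => C.stateExpectation fun h' =>
        C.instantRate P i (C.splice own h h')) =
      C.stateExpectation fun h => C.stateExpectation fun h' =>
        C.instantRate Q i (C.splice own h h') := fun own =>
    C.stateExpectation_congr fun h hh => C.stateExpectation_congr fun h' hh' =>
      hPQ _ (C.stateProb_splice_ne_zero own hh hh')
  cases info
  · exact C.stateExpectation_congr hPQ
  · exact hnested _
  · exact hnested _

theorem continuousOn_expectedRate {K : Set C.Profile}
    (hK : ∀ h, ContinuousOn (fun P : C.Profile => C.instantRate P i h) K) :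
    ContinuousOn (C.expectedRate C.stateExpectation info i) K := by
  cases info
  · exact C.continuousOn_stateExpectation hK
  · exact C.continuousOn_stateExpectation fun h => C.continuousOn_stateExpectation fun h' => hK _
  · exact C.continuousOn_stateExpectation fun h => C.continuousOn_stateExpectation fun h' => hK _

theorem concaveOn_expectedRate {V : Type*} [AddCommGroup V] [Module ℝ V] {K : Set V}
    (hK : Convex ℝ K) {P : V → C.Profile}
    (hP : ∀ h, ConcaveOn ℝ K fun v => C.instantRate (P v) i h) :
    ConcaveOn ℝ K fun v => C.expectedRate C.stateExpectation info i (P v) := by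
  cases info
  · exact C.concaveOn_stateExpectation hK hP
  · exact C.concaveOn_stateExpectation hK fun h => C.concaveOn_stateExpectation hK fun h' => hP _
  · exact C.concaveOn_stateExpectation hK fun h => C.concaveOn_stateExpectation hK fun h' => hP _

theorem one_le_noise_add_interference {P : C.Profile} (hP : ∀ j h, 0 ≤ P j h) (h : C.State) :
    1 ≤ 1 + ∑ j ∈ Finset.univ.erase i, ((h i j : ℝ≥0) : ℝ) * P j h :=
  le_add_of_nonneg_right (Finset.sum_nonneg fun j _ => mul_nonneg (NNReal.coe_nonneg _) (hP j h))

theorem continuousOn_instantRate (h : C.State) :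
    ContinuousOn (fun P : C.Profile => C.instantRate P i h) {P | ∀ j h, 0 ≤ P j h} := by
  unfold instantRate sinr
  have hden : ∀ P ∈ {P : C.Profile | ∀ j h, 0 ≤ P j h},
      0 < 1 + ∑ j ∈ Finset.univ.erase i, ((h i j : ℝ≥0) : ℝ) * P j h := fun P hP =>
    one_pos.trans_le (C.one_le_noise_add_interference i hP h)
  refine ContinuousOn.log (continuousOn_const.add (ContinuousOn.div ?_ ?_
    fun P hP => (hden P hP).ne')) fun P hP => ?_
  · fun_prop
  · fun_prop
  · have : 0 ≤ ((h i i : ℝ≥0) : ℝ) * P i h := mul_nonneg (NNReal.coe_nonneg _) (hP i h)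
    have := div_nonneg this (hden P hP).le
    positivity

/-- The interference `D` does not involve the own power, so the rate is the logarithm of a positive
affine function of it. -/
theorem concaveOn_instantRate {P : C.Profile} (hP : ∀ j h, 0 ≤ P j h) (h : C.State) :
    ConcaveOn ℝ {p : C.Policy | ∀ h, 0 ≤ p h}
      fun p => C.instantRate (Function.update P i p) i h := by
  set D := 1 + ∑ j ∈ Finset.univ.erase i, ((h i j : ℝ≥0) : ℝ) * P j h with hD
  have hD0 : 0 ≤ D := zero_le_one.trans (C.one_le_noise_add_interference i hP h)
  have hrate : ∀ p, C.instantRate (Function.update P i p) i h =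
      Real.log (1 + ((h i i : ℝ≥0) : ℝ) * p h / D) := by
    intro p
    simp only [instantRate, sinr, Function.update_self, hD]
    congr 4
    refine Finset.sum_congr rfl fun j hj => ?_
    rw [Function.update_of_ne (Finset.ne_of_mem_erase hj)]
  simp only [hrate]
  refine ⟨fun p hp q hq a b ha hb _ h => ?_, fun p hp q hq a b ha hb hab => ?_⟩
  · exact add_nonneg (mul_nonneg ha (hp h)) (mul_nonneg hb (hq h))
  · have hpos : ∀ p ∈ {p : C.Policy | ∀ h, 0 ≤ p h},
        1 + ((h i i : ℝ≥0) : ℝ) * p h / D ∈ Set.Ioi (0 : ℝ) := fun p hp => by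
      have := div_nonneg (mul_nonneg (NNReal.coe_nonneg (h i i)) (hp h)) hD0
      exact Set.mem_Ioi.2 (by linarith)
    convert strictConcaveOn_log_Ioi.concaveOn.2 (hpos p hp) (hpos q hq) ha hb hab using 2
    simp only [Pi.add_apply, Pi.smul_apply, smul_eq_mul]
    rw [eq_sub_of_add_eq hab]
    ring

/-! ### Truncation of powers and existence of equilibria -/

/-- A power that a user who respects the budget does not exceed in any state of positive
probability. -/
def powerBound : ℝ := ∑ h, (C.powerBudget i : ℝ) / C.stateProb h

theorem powerBound_nonneg : 0 ≤ C.powerBound i :=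
  Finset.sum_nonneg fun h _ => div_nonneg (NNReal.coe_nonneg _) (C.stateProb_nonneg h)

/-- Already the term of `h` in the expected power is within the budget. Null states contribute 0 to
`powerBound`, division by zero being 0. -/
theorem le_powerBound {p : C.Policy} (hp : p ∈ C.admissible info C.stateExpectation i)
    {h : C.State} (hh : C.stateProb h ≠ 0) : p h ≤ C.powerBound i := by
  have hpos : 0 < C.stateProb h := lt_of_le_of_ne (C.stateProb_nonneg h) hh.symm
  have h1 : C.stateProb h * p h ≤ C.powerBudget i :=
    (Finset.single_le_sum (f := fun h => C.stateProb h * p h)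
      (fun h _ => mul_nonneg (C.stateProb_nonneg h) (hp.1 h)) (Finset.mem_univ h)).trans hp.2.2
  calc p h ≤ C.powerBudget i / C.stateProb h := (le_div_iff₀' hpos).2 h1
    _ ≤ C.powerBound i := Finset.single_le_sum (f := fun h => (C.powerBudget i : ℝ) / C.stateProb h)
      (fun h _ => div_nonneg (NNReal.coe_nonneg _) (C.stateProb_nonneg h)) (Finset.mem_univ h)

/-- The single-slot game with uniformly bounded powers. -/
def boundedGame : StrategicGame (Fin N) (fun _ => C.Policy) where
  strategies := fun i => {p ∈ C.admissible info C.stateExpectation i | ∀ h, p h ≤ C.powerBound i}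
  payoff := C.expectedRate C.stateExpectation info

/-- The budget does not control powers in null states; the cap `powerBound` supplies boundedness
there. -/
theorem isCompact_boundedGame_strategies : IsCompact ((C.boundedGame info).strategies i) := by
  refine (isCompact_Icc (a := (0 : C.Policy)) (b := fun _ => C.powerBound i)).of_isClosed_subset ?_
    fun p hp => ⟨hp.1.1, hp.2⟩
  have : (C.boundedGame info).strategies i =
      ((⋂ h, {p : C.Policy | 0 ≤ p h}) ∩
        ((⋂ h, ⋂ h' : C.State, ⋂ _ : ∀ a b, info.Observes i a b → h a b = h' a b,
          {p : C.Policy | p h = p h'}) ∩ {p | C.stateExpectation p ≤ C.powerBudget i})) ∩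
      ⋂ h, {p : C.Policy | p h ≤ C.powerBound i} := by
    ext p
    simp [boundedGame, admissible]
  rw [this]
  refine ((isClosed_iInter fun h => isClosed_le continuous_const (continuous_apply h)).inter
    ((isClosed_iInter fun h => isClosed_iInter fun h' => isClosed_iInter fun _ =>
      isClosed_eq (continuous_apply h) (continuous_apply h')).inter
    (isClosed_le C.continuous_stateExpectation continuous_const))).inter
    (isClosed_iInter fun h => isClosed_le (continuous_apply h) continuous_const)

theorem convex_boundedGame_strategies : Convex ℝ ((C.boundedGame info).strategies i) := by
  rintro p ⟨⟨hp0, hpi, hpb⟩, hpM⟩ q ⟨⟨hq0, hqi, hqb⟩, hqM⟩ a b ha hb hab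
  refine ⟨⟨fun h => ?_, fun h h' hhh' => ?_, ?_⟩, fun h => ?_⟩
  · exact add_nonneg (mul_nonneg ha (hp0 h)) (mul_nonneg hb (hq0 h))
  · simp only [Pi.add_apply, Pi.smul_apply, hpi h h' hhh', hqi h h' hhh']
  · have := C.stateExpectation_add_smul a b p q
    calc C.stateExpectation (a • p + b • q)
        = a * C.stateExpectation p + b * C.stateExpectation q := this
      _ ≤ a * C.powerBudget i + b * C.powerBudget i := by gcongr
      _ = C.powerBudget i := by rw [← add_mul, hab, one_mul]
  · calc a * p h + b * q h ≤ a * C.powerBound i + b * C.powerBound i := by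
          gcongr
          exacts [hpM h, hqM h]
      _ = C.powerBound i := by rw [← add_mul, hab, one_mul]

theorem boundedGame_strategies_nonempty : ((C.boundedGame info).strategies i).Nonempty :=
  ⟨0, ⟨fun _ => le_rfl, fun _ _ _ => rfl, by simp [stateExpectation]⟩,
    fun _ => C.powerBound_nonneg i⟩

theorem exists_isNashEquilibrium_boundedGame : ∃ P, (C.boundedGame info).IsNashEquilibrium P := by
  have hnonneg : ∀ P ∈ Set.univ.pi (C.boundedGame info).strategies,
      ∀ (j : Fin N) (h : C.State), 0 ≤ P j h := fun P hP j => (hP j (Set.mem_univ j)).1.1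
  refine (C.boundedGame info).exists_isNashEquilibrium
    (C.isCompact_boundedGame_strategies info) (C.convex_boundedGame_strategies info)
    (C.boundedGame_strategies_nonempty info) (fun i => ?_) (fun i P hP => ?_)
  · exact C.continuousOn_expectedRate info i fun h =>
      (C.continuousOn_instantRate i h).mono hnonneg
  · exact C.concaveOn_expectedRate info i (C.convex_boundedGame_strategies info i) fun h =>
      (C.concaveOn_instantRate i (hnonneg P hP) h).subset (fun p hp => hp.1.1)
        (C.convex_boundedGame_strategies info i)

variable {info} in
/-- Bounding the powers does not create new equilibria, since truncating a policy changes it only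
in states of probability zero. -/
theorem isNashEquilibrium_stationaryGame_of_boundedGame {P : C.Profile}
    (hP : (C.boundedGame info).IsNashEquilibrium P) :
    (C.stationaryGame info).IsNashEquilibrium P := by
  refine ⟨fun i => (hP.1 i).1, fun i p hp => ?_⟩
  -- Truncation pointwise keeps the dependence on observed gains and can only lower the expected
  -- power.
  have hq : (fun h => min (p h) (C.powerBound i)) ∈ (C.boundedGame info).strategies i := by
    refine ⟨⟨fun h => le_min (hp.1 h) (C.powerBound_nonneg i), fun h h' hhh' => ?_, ?_⟩,
      fun h => min_le_right _ _⟩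
    · simp only [hp.2.1 h h' hhh']
    · exact (C.stateExpectation_mono fun h => min_le_left _ _).trans hp.2.2
  refine le_of_eq_of_le (C.expectedRate_congr info i fun h hh => ?_) (hP.2 i _ hq)
  simp only [instantRate, sinr, Function.update_self]
  rw [min_eq_left (C.le_powerBound info i hp hh)]
  congr 4
  refine Finset.sum_congr rfl fun j hj => ?_
  rw [Function.update_of_ne (Finset.ne_of_mem_erase hj),
    Function.update_of_ne (Finset.ne_of_mem_erase hj)]

/-- Some profile is an equilibrium of both the long-term and the single-slot game. -/
theorem exists_common_isNashEquilibrium {Ω : Type*} [MeasurableSpace Ω] (μ : Measure Ω)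
    [IsProbabilityMeasure μ] (H : ℕ → (i j : Fin N) → Ω → C.gains i j) (hH : C.IsIIDFading μ H) :
    ∃ P : C.Profile, (C.longTermGame μ H info).IsNashEquilibrium P ∧
      (C.stationaryGame info).IsNashEquilibrium P := by
  obtain ⟨P, hP⟩ := C.exists_isNashEquilibrium_boundedGame info
  have := C.isNashEquilibrium_stationaryGame_of_boundedGame hP
  exact ⟨P, by rwa [C.longTermGame_eq_stationaryGame μ H hH info], this⟩

end InterferenceChannel

end

theorem mainTheorem1 {N : ℕ} (C : InterferenceChannel N)
    {Ω : Type*} [MeasurableSpace Ω] (μ : Measure Ω) [IsProbabilityMeasure μ]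
    (H : ℕ → (i j : Fin N) → Ω → C.gains i j) (hH : C.IsIIDFading μ H) :
    (∃ P : C.Profile,
      (C.longTermGame μ H .complete).IsNashEquilibrium P ∧
      (C.stationaryGame .complete).IsNashEquilibrium P) ∧
    (∃ P : C.Profile,
      (C.longTermGame μ H .incident).IsNashEquilibrium P ∧
      (C.stationaryGame .incident).IsNashEquilibrium P) ∧
    (∃ P : C.Profile,
      (C.longTermGame μ H .direct).IsNashEquilibrium P ∧
      (C.stationaryGame .direct).IsNashEquilibrium P) :=
  ⟨C.exists_common_isNashEquilibrium .complete μ H hH,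
    C.exists_common_isNashEquilibrium .incident μ H hH,
    C.exists_common_isNashEquilibrium .direct μ H hH⟩
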